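/- A hypergraph $\mathcal H=(V,E)$ consists of a finite set $V$ of vertices and a set $E\subset 2^V$ of edges such that no edge is properly contained in another one. For $v\in V$ the vertex-deleted subhypergraph $\mathcal H-v$ has vertex set $V\setminus\{v\}$, and its edges are the edges of $\mathcal H$ that do not contain $v$. The deck of $\mathcal H$ is the collection (with multiplicities) of the hypergraphs $\mathcal H-v$, $v\in V$, each taken up to isomorphism. Let $\mathbb K$ be a field of characteristic $0$. For a hypergraph $\mathcal H$ with vertex set $V=\{v_1,\dots,v_n\}$ let $A=\mathbb K[x_1,\dots,x_n]$, let $I_{\mathcal H}\subset A$ be the ideal generated by the squarefree monomials $\prod_{v_k\in\varepsilon}x_k$, $\varepsilon\in E$, and let $R=A/I_{\mathcal H}$, which is the Stanley-Reisner ring of the independent complex of $\mathcal H$. In the $\mathbb Z^n$-graded minimal free resolution $$\cdots\to F_2\to F_1\to F_0\to R\to 0,\qquad F_i=\bigoplus_{\mathbf b\in\mathbb Z^n}A(-\mathbf b)^{b_{i,\mathbf b}},$$ the numbers $b_{i,\mathbf b}$ are the multigraded Betti numbers of $R$, and $b_{ij}=b_{ij}(\mathcal H)=\sum_{|\mathbf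 b|=j}b_{i,\mathbf b}$, where $|\mathbf b|=b_1+\dots+b_n$, are the graded Betti numbers of $R$. Corollary 4.8. Let $n\ge 3$. The graded Betti numbers $b_{ij}$ of $R=A/I_{\mathcal H}$ are reconstructible for all $j<n$: if $\mathcal H$ and $\mathcal H'$ are hypergraphs on $n$ vertices with the same deck, that is, if there is a bijection $\sigma$ from the vertices of $\mathcal H$ to those of $\mathcal H'$ such that $\mathcal H-v$ is isomorphic to $\mathcal H'-\sigma(v)$ for every vertex $v$, then $b_{ij}(\mathcal H)=b_{ij}(\mathcal H')$ for all $i\ge 0$ and all integers $j<n$. -/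

import Mathlib

open MvPolynomial

/-- A (finite, when `V` is finite) hypergraph on the vertex set `V`: a set of subsets of `V`, the
edges, no one of which is properly contained in another. -/
structure SpernerHypergraph (V : Type*) where
  edges : Set (Finset V)
  antichain : ∀ e ∈ edges, ∀ f ∈ edges, e ⊆ f → e = f

namespace SpernerHypergraph

/-- The vertex-induced subhypergraph `H_W`: its vertices are the elements of `W`, its edges are
all the edges of `H` that are contained in `W`. -/
def induce {V : Type*} (H : SpernerHypergraph V) (W : Set V) : SpernerHypergraph W where
  edges := {e | e.map (Function.Embedding.subtype (· ∈ W)) ∈ H.edges}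
  antichain := fun _ he _ hf hef =>
    Finset.map_injective _ (H.antichain _ he _ hf (Finset.map_subset_map.2 hef))

/-- The card `H - v`: the vertex `v` is deleted, together with all the edges that contain it. -/
def deleteVertex {V : Type*} (H : SpernerHypergraph V) (v : V) :
    SpernerHypergraph ({v}ᶜ : Set V) :=
  H.induce {v}ᶜ

/-- `H` and `G` are isomorphic: some bijection of the vertices carries the edges of `H` exactly to
the edges of `G`. -/
def Isomorphic {V W : Type*} (H : SpernerHypergraph V) (G : SpernerHypergraph W) : Prop :=
  ∃ φ : V ≃ W, ∀ e : Finset V, e ∈ H.edges ↔ e.map φ.toEmbedding ∈ G.edges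

/-- `H` and `G` have the same deck, that is, the same collection (with multiplicities) of
vertex-deleted subhypergraphs up to isomorphism. -/
def SameDeck {V W : Type*} (H : SpernerHypergraph V) (G : SpernerHypergraph W) : Prop :=
  ∃ σ : V ≃ W, ∀ v : V, (H.deleteVertex v).Isomorphic (G.deleteVertex (σ v))

/-- The edge ideal `I_H` in the polynomial ring `A` with one variable for each vertex. The quotient
`A ⧸ I_H` is the Stanley-Reisner ring of the independent complex of `H`. -/
noncomputable def edgeIdeal {V : Type*} (K : Type*) [Field K] (H : SpernerHypergraph V) : Ideal (MvPolynomial V K) :=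
  Ideal.span {p | ∃ e ∈ H.edges, p = ∏ v ∈ e, X v}

end SpernerHypergraph

namespace Multigraded

variable {V K : Type*} [Field K]

/-- `p` lies in the component `A_b` of the `ℤ^V`-graded polynomial ring `A = K[x_v : v ∈ V]`: it is
a scalar multiple of `∏ v, x_v ^ (b v)` (and zero if `b` has a negative entry). -/
def IsHomog (b : V → ℤ) (p : MvPolynomial V K) : Prop :=
  ∀ m ∈ p.support, ∀ v, (m v : ℤ) = b v

/-- `f` lies in the component of degree `b` of the `ℤ^V`-graded free module `⨁ k, A(-deg k)`, whose
`k`-th basis vector has degree `deg k`: note that `A(-c)_b = A_(b - c)`. -/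
def IsHomogVec {r : ℕ} (deg : Fin r → V → ℤ) (b : V → ℤ) (f : Fin r → MvPolynomial V K) : Prop :=
  ∀ k, IsHomog (b - deg k) (f k)

/-- The maximal ideal of `A` generated by the variables. -/
noncomputable def irrelevantIdeal (V K : Type*) [Field K] : Ideal (MvPolynomial V K) :=
  Ideal.span (Set.range X)

/-- A `ℤ^V`-graded minimal free resolution of the `A`-module `A ⧸ I`
(`⋯ → F 2 → F 1 → F 0 → A ⧸ I → 0`), where `F i = ⨁ k : Fin (rank i), A(-deg i k)`. -/
structure MinimalFreeResolution (I : Ideal (MvPolynomial V K)) where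
  rank : ℕ → ℕ
  deg : (i : ℕ) → Fin (rank i) → V → ℤ
  d : (i : ℕ) → (Fin (rank (i + 1)) → MvPolynomial V K) →ₗ[MvPolynomial V K]
    (Fin (rank i) → MvPolynomial V K)
  aug : (Fin (rank 0) → MvPolynomial V K) →ₗ[MvPolynomial V K] (MvPolynomial V K ⧸ I)
  /-- the differentials are multigraded of degree zero -/
  d_homog : ∀ i b f, IsHomogVec (deg (i + 1)) b f → IsHomogVec (deg i) b (d i f)
  /-- the augmentation is multigraded of degree zero -/
  aug_homog : ∀ b f, IsHomogVec (deg 0) b f → ∃ p, IsHomog b p ∧ aug f = Ideal.Quotient.mk I p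
  aug_surjective : Function.Surjective aug
  exact_aug : Function.Exact (d 0) aug
  exact : ∀ i, Function.Exact (d (i + 1)) (d i)
  /-- minimality: the image of each differential is contained in `𝔪 F i` -/
  minimal : ∀ i, LinearMap.range (d i) ≤ irrelevantIdeal V K • ⊤

namespace MinimalFreeResolution

/-- The multigraded Betti number `b_{i,b}`: the number of summands `A(-b)` of `F i`. -/
noncomputable def multigradedBetti {I : Ideal (MvPolynomial V K)} (F : MinimalFreeResolution I)
    (i : ℕ) (b : V → ℤ) : ℕ :=
  Nat.card {k : Fin (F.rank i) // F.deg i k = b}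

/-- The graded Betti number `b_{ij}`, the sum of the `b_{i,b}` over all `b` with `|b| = j`. Only
finitely many of the summands are nonzero. -/
noncomputable def gradedBetti [Fintype V] {I : Ideal (MvPolynomial V K)}
    (F : MinimalFreeResolution I) (i : ℕ) (j : ℤ) : ℕ :=
  ∑ᶠ (b : V → ℤ) (_ : ∑ v, b v = j), F.multigradedBetti i b

end MinimalFreeResolution

end Multigraded

/-!
Set all variables equal to one in a multigraded minimal free resolution of `A ⧸ I`, for a monomial
ideal `I`. The result is a complex of vector spaces filtered by the multidegrees, exact in each
filtration step except for a one-dimensional cokernel `A_b ⧸ I_b` when `b` is the degree of a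
standard monomial. Minimal covers are unique, so by induction on the homological degree the
multigraded Betti numbers in a lower set `Q` of degrees depend only on the standard degrees in `Q`.

For `Q = {b | b v ≤ 0}` only the edges of `H` that avoid `v` matter, so `H - v` determines these
Betti numbers up to a relabelling of the vertices. If `|b| = j < n`, then `b v ≤ 0` for some `v`;
distributing the weight of `b` evenly among all such `v` writes `b_{ij}` as a sum over the deck.
-/

namespace Multigraded

section DegreeSupport

variable {K P ι κ E : Type*} [Field K] [AddCommGroup E] [Module K E]

/-- The span of the basis vectors of `ι →₀ K` whose degree lies in `T`. For `T = Set.Iic b` this is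
the component of degree `b` of the `P`-graded free module on generators of degrees `deg k`: a
generator of degree at most `b` contributes one dimension to it, the others contribute nothing. -/
abbrev degSupported (K : Type*) [Field K] (deg : ι → P) (T : Set P) : Submodule K (ι →₀ K) :=
  Finsupp.supported K K (deg ⁻¹' T)

theorem degSupported_mono {deg : ι → P} {S T : Set P} (h : S ⊆ T) :
    degSupported K deg S ≤ degSupported K deg T :=
  Finsupp.supported_mono (Set.preimage_mono h)

theorem single_mem_degSupported {deg : ι → P} {T : Set P} {k : ι} (h : deg k ∈ T) (c : K) :
    Finsupp.single k c ∈ degSupported K deg T :=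
  Finsupp.single_mem_supported K c h

theorem apply_mem_of_mem_degSupported {deg : ι → P} {T : Set P} {N : Submodule K E}
    {f : (ι →₀ K) →ₗ[K] E} (h : ∀ k, deg k ∈ T → f (Finsupp.single k 1) ∈ N)
    {a : ι →₀ K} (ha : a ∈ degSupported K deg T) : f a ∈ N := by
  rw [degSupported, Finsupp.supported_eq_span_single] at ha
  refine (Submodule.map_span_le f _ N).2 ?_ ⟨a, ha, rfl⟩
  rintro _ ⟨k, hk, rfl⟩
  exact h k hk

theorem finrank_degSupported [Finite ι] (deg : ι → P) (T : Set P) :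
    Module.finrank K (degSupported K deg T) = (deg ⁻¹' T).ncard := by
  have := Fintype.ofFinite (deg ⁻¹' T)
  rw [(Finsupp.supportedEquivFinsupp (deg ⁻¹' T)).finrank_eq, Module.finrank_finsupp_self,
    ← Nat.card_eq_fintype_card, Nat.card_coe_set_eq]

theorem finrank_map_degSupported [Finite ι] {deg : ι → P} {f : (ι →₀ K) →ₗ[K] E} {T : Set P}
    (hf : ∀ a ∈ degSupported K deg T, f a = 0 → a = 0) :
    Module.finrank K ((degSupported K deg T).map f) = (deg ⁻¹' T).ncard := by
  rw [← finrank_degSupported (K := K), ← LinearMap.range_domRestrict]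
  refine LinearMap.finrank_range_of_inj ((injective_iff_map_eq_zero _).2 fun a ha => ?_)
  exact Subtype.ext (hf a a.2 ha)

variable [PartialOrder P]

theorem eq_zero_of_map_eq_zero_of_sub_mem_Iio {deg : ι → P} {Q : Set P}
    {u : (ι →₀ K) →ₗ[K] (ι →₀ K)}
    (hu : ∀ k, deg k ∈ Q →
      u (Finsupp.single k 1) - Finsupp.single k 1 ∈ degSupported K deg (Set.Iio (deg k)))
    {a : ι →₀ K} (ha : a ∈ degSupported K deg Q) (h : u a = 0) : a = 0 := by
  by_contra ha0
  obtain ⟨m, hm, hmax⟩ := a.support.exists_maximalFor deg (Finsupp.support_nonempty_iff.2 ha0)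
  -- No other generator in the support of `a` can contribute to the coordinate `m` of `u a - a`.
  have hsub : (u - LinearMap.id : (ι →₀ K) →ₗ[K] (ι →₀ K)) a ∈ degSupported K deg {deg m}ᶜ := by
    refine apply_mem_of_mem_degSupported (T := deg '' a.support) ?_
      ((Finsupp.mem_supported K a).2 (Set.subset_preimage_image deg _))
    rintro k ⟨l, hl, hlk⟩
    have hmk : ¬deg m < deg k := fun hlt => (hlk ▸ hlt).not_ge (hmax hl (hlk ▸ hlt).le)
    refine degSupported_mono (S := Set.Iio (deg k)) ?_ (hu k (hlk ▸ ha hl))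
    exact Set.subset_compl_singleton_iff.2 hmk
  have hcoord : (u a - a) m = 0 := by
    by_contra hne
    exact hsub (Finsupp.mem_support_iff.2 hne) rfl
  rw [h] at hcoord
  exact Finsupp.mem_support_iff.1 hm (by simpa using hcoord)

/-- A linear map of degree zero: it sends every generator to a combination of generators of
smaller or equal degree. -/
def IsFiltered (deg : ι → P) (deg' : κ → P) (f : (ι →₀ K) →ₗ[K] (κ →₀ K)) : Prop :=
  ∀ k, f (Finsupp.single k 1) ∈ degSupported K deg' (Set.Iic (deg k))

theorem IsFiltered.apply_mem {deg : ι → P} {deg' : κ → P} {f : (ι →₀ K) →ₗ[K] (κ →₀ K)}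
    (hf : IsFiltered deg deg' f) {T : Set P} (hT : IsLowerSet T) {a : ι →₀ K}
    (ha : a ∈ degSupported K deg T) : f a ∈ degSupported K deg' T :=
  apply_mem_of_mem_degSupported (fun k hk => degSupported_mono (hT.Iic_subset hk) (hf k)) ha

theorem exists_isFiltered_lift {deg : ι → P} {deg' : κ → P} {π : (ι →₀ K) →ₗ[K] E}
    {π' : (κ →₀ K) →ₗ[K] E} {Q : Set P}
    (h : ∀ k, deg k ∈ Q →
      π (Finsupp.single k 1) ∈ (degSupported K deg' (Set.Iic (deg k))).map π') :
    ∃ f : (ι →₀ K) →ₗ[K] (κ →₀ K), IsFiltered deg deg' f ∧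
      ∀ a ∈ degSupported K deg Q, π' (f a) = π a := by
  have hgen : ∀ k, ∃ x ∈ degSupported K deg' (Set.Iic (deg k)),
      deg k ∈ Q → π' x = π (Finsupp.single k 1) := fun k => by
    by_cases hk : deg k ∈ Q
    · obtain ⟨x, hx, hxk⟩ := h k hk
      exact ⟨x, hx, fun _ => hxk⟩
    · exact ⟨0, zero_mem _, fun hk' => absurd hk' hk⟩
  choose x hx hxk using hgen
  refine ⟨Finsupp.linearCombination K x, fun k => by simpa using hx k, fun a ha => ?_⟩
  suffices hdiff : (π' ∘ₗ Finsupp.linearCombination K x - π) a ∈ (⊥ : Submodule K E) from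
    sub_eq_zero.1 hdiff
  exact apply_mem_of_mem_degSupported (fun k hk => by simp [hxk k hk]) ha

theorem ncard_preimage_le_of_isFiltered [Finite ι] [Finite κ] {deg : ι → P} {deg' : κ → P}
    {f : (ι →₀ K) →ₗ[K] (κ →₀ K)} {T : Set P} (hf : IsFiltered deg deg' f)
    (hinj : ∀ a ∈ degSupported K deg T, f a = 0 → a = 0) (hT : IsLowerSet T) :
    (deg ⁻¹' T).ncard ≤ (deg' ⁻¹' T).ncard := by
  rw [← finrank_map_degSupported hinj, ← finrank_degSupported (K := K)]
  exact Submodule.finrank_mono (Submodule.map_le_iff_le_comap.2 fun a ha => hf.apply_mem hT ha)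

end DegreeSupport

section Resolution

variable {K P ι κ E : Type*} [Field K] [AddCommGroup E] [Module K E] [PartialOrder P]

/-- The degree-`b` component of the kernel of a graded map from the free module with generators of
degrees `deg k`. In the degrees `b ∈ live` the map is given by `π`; in all other degrees its target
vanishes, whatever the value of `π`. -/
noncomputable def kernelAt (deg : ι → P) (π : (ι →₀ K) →ₗ[K] E) (live : Set P) (b : P) :
    Submodule K (ι →₀ K) :=
  degSupported K deg (Set.Iic b) ⊓ ⨅ _ : b ∈ live, LinearMap.ker π

theorem mem_kernelAt {deg : ι → P} {π : (ι →₀ K) →ₗ[K] E} {live : Set P} {b : P} {a : ι →₀ K} :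
    a ∈ kernelAt deg π live b ↔
      a ∈ degSupported K deg (Set.Iic b) ∧ (b ∈ live → π a = 0) := by
  simp [kernelAt]

theorem kernelAt_congr {deg : ι → P} {E' : Type*} [AddCommGroup E'] [Module K E']
    {π : (ι →₀ K) →ₗ[K] E} {π' : (ι →₀ K) →ₗ[K] E'} {live live' : Set P} {b : P}
    (hlive : b ∈ live ↔ b ∈ live')
    (hπ : ∀ a ∈ degSupported K deg (Set.Iic b), π a = 0 ↔ π' a = 0) :
    kernelAt deg π live b = kernelAt deg π' live' b := by
  ext a
  rw [mem_kernelAt, mem_kernelAt, hlive]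
  exact and_congr_right fun ha => imp_congr_right fun _ => hπ a ha

/-- `f` restricts, in the degrees in `Q`, to an isomorphism of the free modules with generators of
degrees `deg k` and `deg' k` which carries the submodule `Z` onto `Z'`. -/
structure IsIsoOn (Q : Set P) (deg : ι → P) (deg' : κ → P) (Z : P → Submodule K (ι →₀ K))
    (Z' : P → Submodule K (κ →₀ K)) (f : (ι →₀ K) →ₗ[K] (κ →₀ K)) : Prop where
  eq_zero_of_map_eq_zero : ∀ a ∈ degSupported K deg Q, f a = 0 → a = 0
  map_degSupported : ∀ T ⊆ Q, IsLowerSet T →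
    (degSupported K deg T).map f = degSupported K deg' T
  map_submodule : ∀ b ∈ Q, (Z b).map f = Z' b

theorem ncard_fiber_add_ncard_preimage_Iio [Finite ι] (deg : ι → P) (b : P) :
    (deg ⁻¹' {b}).ncard + (deg ⁻¹' Set.Iio b).ncard = (deg ⁻¹' Set.Iic b).ncard := by
  rw [← Set.Iio_insert, ← Set.singleton_union, Set.preimage_union,
    Set.ncard_union_eq (Disjoint.preimage deg (Set.disjoint_singleton_left.2 Set.self_notMem_Iio))]

theorem IsIsoOn.ncard_fiber_eq [Finite ι] [Finite κ] {Q : Set P} {deg : ι → P} {deg' : κ → P}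
    {Z : P → Submodule K (ι →₀ K)} {Z' : P → Submodule K (κ →₀ K)}
    {f : (ι →₀ K) →ₗ[K] (κ →₀ K)} (hf : IsIsoOn Q deg deg' Z Z' f) (hQ : IsLowerSet Q) {b : P}
    (hb : b ∈ Q) : (deg ⁻¹' {b}).ncard = (deg' ⁻¹' {b}).ncard := by
  have hlower : ∀ T ⊆ Q, IsLowerSet T → (deg ⁻¹' T).ncard = (deg' ⁻¹' T).ncard := by
    intro T hTQ hT
    rw [← finrank_map_degSupported fun a ha =>
        hf.eq_zero_of_map_eq_zero a (degSupported_mono hTQ ha),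
      hf.map_degSupported T hTQ hT, finrank_degSupported]
  have hIic := hlower _ (hQ.Iic_subset hb) (isLowerSet_Iic b)
  have hIio := hlower _ (Set.Iio_subset_Iic_self.trans (hQ.Iic_subset hb)) (isLowerSet_Iio b)
  rw [← ncard_fiber_add_ncard_preimage_Iio, ← ncard_fiber_add_ncard_preimage_Iio, hIio] at hIic
  exact Nat.add_right_cancel hIic

variable {deg : ι → P} {deg' : κ → P} {π : (ι →₀ K) →ₗ[K] E} {π' : (κ →₀ K) →ₗ[K] E}
  {live Q : Set P} {f : (ι →₀ K) →ₗ[K] (κ →₀ K)} {g : (κ →₀ K) →ₗ[K] (ι →₀ K)}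

theorem sub_mem_kernelAt_of_lift (hQ : IsLowerSet Q) (hf : IsFiltered deg deg' f)
    (hg : IsFiltered deg' deg g) (hπf : ∀ a ∈ degSupported K deg Q, π' (f a) = π a)
    (hπg : ∀ a ∈ degSupported K deg' Q, π (g a) = π' a) {b : P} (hb : b ∈ Q) {a : ι →₀ K}
    (ha : a ∈ degSupported K deg (Set.Iic b)) : g (f a) - a ∈ kernelAt deg π live b := by
  have haQ := degSupported_mono (hQ.Iic_subset hb) ha
  have hgf := hg.apply_mem (isLowerSet_Iic b) (hf.apply_mem (isLowerSet_Iic b) ha)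
  refine mem_kernelAt.2 ⟨sub_mem hgf ha, fun _ => ?_⟩
  rw [map_sub, hπg _ (hf.apply_mem hQ haQ), hπf a haQ, sub_self]

theorem eq_zero_of_lift_eq_zero (hQ : IsLowerSet Q) (hf : IsFiltered deg deg' f)
    (hg : IsFiltered deg' deg g) (hπf : ∀ a ∈ degSupported K deg Q, π' (f a) = π a)
    (hπg : ∀ a ∈ degSupported K deg' Q, π (g a) = π' a)
    (hmin : ∀ b ∈ Q, kernelAt deg π live b ≤ degSupported K deg (Set.Iio b))
    {a : ι →₀ K} (ha : a ∈ degSupported K deg Q) (h : f a = 0) : a = 0 :=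
  eq_zero_of_map_eq_zero_of_sub_mem_Iio (u := g ∘ₗ f)
    (fun k hk => hmin _ hk (sub_mem_kernelAt_of_lift hQ hf hg hπf hπg hk
      (single_mem_degSupported (T := Set.Iic (deg k)) le_rfl (1 : K)))) ha
    (by rw [LinearMap.comp_apply, h, map_zero])

theorem exists_isIsoOn_kernelAt [Finite ι] [Finite κ] (hQ : IsLowerSet Q)
    (hmin : ∀ b ∈ Q, kernelAt deg π live b ≤ degSupported K deg (Set.Iio b))
    (hmin' : ∀ b ∈ Q, kernelAt deg' π' live b ≤ degSupported K deg' (Set.Iio b))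
    (hlift : ∀ k, deg k ∈ Q →
      π (Finsupp.single k 1) ∈ (degSupported K deg' (Set.Iic (deg k))).map π')
    (hlift' : ∀ k, deg' k ∈ Q →
      π' (Finsupp.single k 1) ∈ (degSupported K deg (Set.Iic (deg' k))).map π) :
    ∃ f, IsIsoOn Q deg deg' (kernelAt deg π live) (kernelAt deg' π' live) f := by
  obtain ⟨f, hf, hπf⟩ := exists_isFiltered_lift hlift
  obtain ⟨g, hg, hπg⟩ := exists_isFiltered_lift hlift'
  have hinj : ∀ a ∈ degSupported K deg Q, f a = 0 → a = 0 :=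
    fun a => eq_zero_of_lift_eq_zero hQ hf hg hπf hπg hmin
  have hinj' : ∀ a ∈ degSupported K deg' Q, g a = 0 → a = 0 :=
    fun a => eq_zero_of_lift_eq_zero hQ hg hf hπg hπf hmin'
  have hmap : ∀ T ⊆ Q, IsLowerSet T → (degSupported K deg T).map f = degSupported K deg' T :=
    fun T hTQ hT => Submodule.eq_of_le_of_finrank_le
      (Submodule.map_le_iff_le_comap.2 fun a ha => hf.apply_mem hT ha) (by
        rw [finrank_degSupported,
          finrank_map_degSupported fun a ha => hinj a (degSupported_mono hTQ ha)]
        exact ncard_preimage_le_of_isFiltered hg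
          (fun a ha => hinj' a (degSupported_mono hTQ ha)) hT)
  refine ⟨f, hinj, hmap, fun b hb => le_antisymm ?_ fun y hy => ?_⟩
  · rw [Submodule.map_le_iff_le_comap]
    intro a ha
    obtain ⟨hab, hπa⟩ := mem_kernelAt.1 ha
    exact mem_kernelAt.2 ⟨hf.apply_mem (isLowerSet_Iic b) hab, fun hlive => by
      rw [hπf a (degSupported_mono (hQ.Iic_subset hb) hab), hπa hlive]⟩
  · obtain ⟨hyb, hπy⟩ := mem_kernelAt.1 hy
    rw [← hmap _ (hQ.Iic_subset hb) (isLowerSet_Iic b)] at hyb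
    obtain ⟨a, ha, rfl⟩ := hyb
    exact ⟨a, mem_kernelAt.2 ⟨ha, fun hlive => by
      rw [← hπf a (degSupported_mono (hQ.Iic_subset hb) ha), hπy hlive]⟩, rfl⟩

end Resolution

section AugmentedComplex

variable {K P : Type*} [Field K] [PartialOrder P] {ι ι' : ℕ → Type*}

/-- The data of a sequence `⋯ → K^(ι 1) → K^(ι 0) → K` of linear maps. -/
structure AugmentedComplex (K : Type*) [Field K] (ι : ℕ → Type*) where
  d : ∀ i, (ι (i + 1) →₀ K) →ₗ[K] (ι i →₀ K)
  aug : (ι 0 →₀ K) →ₗ[K] K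

/-- The degree-`b` component of the cycles in position `i`, when the basis vectors are given the
degrees `deg i k` and the target of the augmentation is `K` in the degrees `b ∈ live` and zero in
all others. -/
noncomputable def AugmentedComplex.cycles (C : AugmentedComplex K ι) (deg : ∀ i, ι i → P)
    (live : Set P) : ∀ i, P → Submodule K (ι i →₀ K)
  | 0 => kernelAt (deg 0) C.aug live
  | i + 1 => kernelAt (deg (i + 1)) (C.d i) Set.univ

/-- `C` is, degree by degree, a minimal free resolution, with generators of degrees `deg i k`, of
the graded module that is `K` in the degrees in `live` and zero in all others. -/
structure AugmentedComplex.IsMinimalResolution (C : AugmentedComplex K ι) (deg : ∀ i, ι i → P)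
    (live : Set P) : Prop where
  aug_single : ∀ k, deg 0 k ∉ live → C.aug (Finsupp.single k 1) = 0
  map_aug : ∀ b ∈ live, (degSupported K (deg 0) (Set.Iic b)).map C.aug = ⊤
  map_d : ∀ i b, (degSupported K (deg (i + 1)) (Set.Iic b)).map (C.d i) = C.cycles deg live i b
  cycles_le : ∀ i b, C.cycles deg live i b ≤ degSupported K (deg i) (Set.Iio b)

namespace AugmentedComplex.IsMinimalResolution

variable {C : AugmentedComplex K ι} {C' : AugmentedComplex K ι'} {deg : ∀ i, ι i → P}
  {deg' : ∀ i, ι' i → P} {live live' : Set P}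

theorem mapDeg {P' : Type*} [PartialOrder P'] (hC : C.IsMinimalResolution deg live)
    (e : P ≃o P') : C.IsMinimalResolution (fun i k => e (deg i k)) (e.symm ⁻¹' live) := by
  have hIic : ∀ i b, degSupported K (fun k => e (deg i k)) (Set.Iic b) =
      degSupported K (deg i) (Set.Iic (e.symm b)) := fun i b => by
    simp only [degSupported, Set.preimage, Set.mem_Iic, e.le_symm_apply]
  have hIio : ∀ i b, degSupported K (fun k => e (deg i k)) (Set.Iio b) =
      degSupported K (deg i) (Set.Iio (e.symm b)) := fun i b => by
    simp only [degSupported, Set.preimage, Set.mem_Iio, e.lt_symm_apply]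
  have hcycles : ∀ i b, C.cycles (fun i k => e (deg i k)) (e.symm ⁻¹' live) i b =
      C.cycles deg live i (e.symm b)
    | 0, b => by simp only [cycles, kernelAt, hIic, Set.mem_preimage]
    | i + 1, b => by simp only [cycles, kernelAt, hIic, Set.mem_univ]
  refine ⟨fun k hk => hC.aug_single k (by simpa using hk), fun b hb => ?_, fun i b => ?_,
    fun i b => ?_⟩
  · rw [hIic, hC.map_aug _ hb]
  · rw [hIic, hcycles, hC.map_d]
  · rw [hIio, hcycles]
    exact hC.cycles_le i _

theorem aug_single_mem_map_aug (hC : C.IsMinimalResolution deg live)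
    (hC' : C'.IsMinimalResolution deg' live') {k : ι 0} (hk : deg 0 k ∈ live → deg 0 k ∈ live') :
    C.aug (Finsupp.single k 1) ∈ (degSupported K (deg' 0) (Set.Iic (deg 0 k))).map C'.aug := by
  by_cases hlive : deg 0 k ∈ live
  · rw [hC'.map_aug _ (hk hlive)]
    exact Submodule.mem_top
  · rw [hC.aug_single k hlive]
    exact zero_mem _

theorem kernelAt_comp_d (hC : C.IsMinimalResolution deg live) {i : ℕ}
    {f : (ι i →₀ K) →ₗ[K] (ι' i →₀ K)} {b : P}
    (hf : ∀ a ∈ degSupported K (deg i) (Set.Iic b), f a = 0 → a = 0) :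
    kernelAt (deg (i + 1)) (f ∘ₗ C.d i) Set.univ b = C.cycles deg live (i + 1) b := by
  refine kernelAt_congr Iff.rfl fun a ha => ⟨fun h => hf _ ?_ h, fun h => ?_⟩
  · exact degSupported_mono Set.Iio_subset_Iic_self
      (hC.cycles_le i b (hC.map_d i b ▸ Submodule.mem_map_of_mem ha))
  · rw [LinearMap.comp_apply, h, map_zero]

theorem exists_isIsoOn [∀ i, Finite (ι i)] [∀ i, Finite (ι' i)]
    (hC : C.IsMinimalResolution deg live) (hC' : C'.IsMinimalResolution deg' live') {Q : Set P}
    (hQ : IsLowerSet Q) (hlive : ∀ b ∈ Q, b ∈ live ↔ b ∈ live') (i : ℕ) :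
    ∃ f, IsIsoOn Q (deg i) (deg' i) (C.cycles deg live i) (C'.cycles deg' live' i) f := by
  induction i with
  | zero =>
    have hcycles' : ∀ b ∈ Q, kernelAt (deg' 0) C'.aug live b = C'.cycles deg' live' 0 b :=
      fun b hb => kernelAt_congr (hlive b hb) fun _ _ => Iff.rfl
    obtain ⟨f, hf⟩ := exists_isIsoOn_kernelAt hQ
      (fun b _ => hC.cycles_le 0 b) (fun b hb => (hcycles' b hb).trans_le (hC'.cycles_le 0 b))
      (fun k hk => hC.aug_single_mem_map_aug hC' (hlive _ hk).1)
      (fun k hk => hC'.aug_single_mem_map_aug hC (hlive _ hk).2)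
    exact ⟨f, hf.eq_zero_of_map_eq_zero, hf.map_degSupported,
      fun b hb => (hf.map_submodule b hb).trans (hcycles' b hb)⟩
  | succ i ih =>
    -- Transporting the first complex along `f` gives both differentials the same target.
    obtain ⟨f, hf⟩ := ih
    have hcycles : ∀ b ∈ Q,
        kernelAt (deg (i + 1)) (f ∘ₗ C.d i) Set.univ b = C.cycles deg live (i + 1) b :=
      fun b hb => hC.kernelAt_comp_d fun a ha =>
        hf.eq_zero_of_map_eq_zero a (degSupported_mono (hQ.Iic_subset hb) ha)
    have hrange : ∀ b ∈ Q, (degSupported K (deg (i + 1)) (Set.Iic b)).map (f ∘ₗ C.d i) =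
        (degSupported K (deg' (i + 1)) (Set.Iic b)).map (C'.d i) := fun b hb => by
      rw [Submodule.map_comp, hC.map_d, hf.map_submodule b hb, hC'.map_d]
    obtain ⟨g, hg⟩ := exists_isIsoOn_kernelAt hQ
      (fun b hb => (hcycles b hb).trans_le (hC.cycles_le (i + 1) b))
      (fun b _ => hC'.cycles_le (i + 1) b)
      (fun k hk => hrange _ hk ▸
        Submodule.mem_map_of_mem (single_mem_degSupported Set.self_mem_Iic 1))
      (fun k hk => hrange _ hk ▸
        Submodule.mem_map_of_mem (single_mem_degSupported Set.self_mem_Iic 1))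
    exact ⟨g, hg.eq_zero_of_map_eq_zero, hg.map_degSupported,
      fun b hb => hcycles b hb ▸ hg.map_submodule b hb⟩

theorem ncard_fiber_eq [∀ i, Finite (ι i)] [∀ i, Finite (ι' i)]
    (hC : C.IsMinimalResolution deg live) (hC' : C'.IsMinimalResolution deg' live') {Q : Set P}
    (hQ : IsLowerSet Q) (hlive : ∀ b ∈ Q, b ∈ live ↔ b ∈ live') (i : ℕ) {b : P} (hb : b ∈ Q) :
    (deg i ⁻¹' {b}).ncard = (deg' i ⁻¹' {b}).ncard :=
  let ⟨_, hf⟩ := hC.exists_isIsoOn hC' hQ hlive i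
  hf.ncard_fiber_eq hQ hb

end AugmentedComplex.IsMinimalResolution

end AugmentedComplex

section Homogeneous

variable {V K : Type*} [Field K]

/-- The degree in `ℤ^V` of the monomial with exponents `m`. -/
def multidegree (m : V →₀ ℕ) : V → ℤ := fun v => m v

theorem multidegree_injective : Function.Injective (multidegree (V := V)) := fun _ _ h =>
  Finsupp.ext fun v => Int.ofNat_injective (congrFun h v)

theorem exists_multidegree_eq [Finite V] {b : V → ℤ} (hb : 0 ≤ b) : ∃ m, multidegree m = b :=
  ⟨Finsupp.equivFunOnFinite.symm fun v => (b v).toNat,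
    funext fun v => Int.toNat_of_nonneg (hb v)⟩

theorem isHomog_iff_isWeightedHomogeneous [DecidableEq V] {b : V → ℤ} {p : MvPolynomial V K} :
    IsHomog b p ↔ IsWeightedHomogeneous (fun v => (Pi.single v 1 : V → ℤ)) p b := by
  refine forall_congr' fun m => ?_
  rw [mem_support_iff, Finsupp.weight_apply, Finsupp.sum, _root_.funext_iff]
  refine imp_congr_right fun _ => forall_congr' fun v => ?_
  by_cases h : m v = 0 <;> simp [Pi.single_apply, h]

theorem isHomog_monomial (m : V →₀ ℕ) (c : K) : IsHomog (multidegree m) (monomial m c) :=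
  fun _ hm v => by rw [Finset.mem_singleton.1 (support_monomial_subset hm)]; rfl

theorem isHomog_zero (b : V → ℤ) : IsHomog b (0 : MvPolynomial V K) := by
  classical
  exact isHomog_iff_isWeightedHomogeneous.2 (isWeightedHomogeneous_zero K _ b)

theorem isHomog_one : IsHomog 0 (1 : MvPolynomial V K) := by
  classical
  exact isHomog_iff_isWeightedHomogeneous.2 (isWeightedHomogeneous_one K _)

theorem IsHomog.mul {b c : V → ℤ} {p q : MvPolynomial V K} (hp : IsHomog b p)
    (hq : IsHomog c q) : IsHomog (b + c) (p * q) := by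
  classical
  rw [isHomog_iff_isWeightedHomogeneous] at hp hq ⊢
  exact hp.mul hq

theorem IsHomog.sum {ι : Type*} {s : Finset ι} {b : V → ℤ} {p : ι → MvPolynomial V K}
    (hp : ∀ k ∈ s, IsHomog b (p k)) : IsHomog b (∑ k ∈ s, p k) := by
  classical
  simp only [isHomog_iff_isWeightedHomogeneous] at hp ⊢
  exact .sum s p b hp

theorem eval_one_monomial (m : V →₀ ℕ) (c : K) : eval 1 (monomial m c) = c := by
  simp [eval_monomial, Finsupp.prod]

theorem IsHomog.eq_monomial {m : V →₀ ℕ} {p : MvPolynomial V K} (hp : IsHomog (multidegree m) p) :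
    p = monomial m (eval 1 p) := by
  have h : p = monomial m (coeff m p) := eq_monomial_of_support_subset_singleton fun m' hm' =>
    multidegree_injective (funext (hp m' hm'))
  have hcoeff : eval 1 p = coeff m p := (congrArg (eval 1) h).trans (eval_one_monomial m _)
  rwa [hcoeff]

theorem IsHomog.exists_eq_multidegree {b : V → ℤ} {p : MvPolynomial V K} (hp : IsHomog b p)
    (hp0 : p ≠ 0) : ∃ m, multidegree m = b :=
  let ⟨m, hm⟩ := support_nonempty.2 hp0
  ⟨m, funext (hp m hm)⟩

theorem IsHomog.eval_one_eq_zero_iff {b : V → ℤ} {p : MvPolynomial V K} (hp : IsHomog b p) :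
    eval 1 p = 0 ↔ p = 0 := by
  refine ⟨fun h => ?_, fun h => by rw [h, map_zero]⟩
  by_contra hp0
  obtain ⟨m, rfl⟩ := hp.exists_eq_multidegree hp0
  exact hp0 (by rw [hp.eq_monomial, h, map_zero])

theorem IsHomog.nonneg {b : V → ℤ} {p : MvPolynomial V K} (hp : IsHomog b p) (hp0 : p ≠ 0) :
    0 ≤ b := by
  obtain ⟨m, rfl⟩ := hp.exists_eq_multidegree hp0
  exact fun v => Int.natCast_nonneg (m v)

theorem exists_isHomog_eval_one_eq [Finite V] {b : V → ℤ} (hb : 0 ≤ b) (c : K) :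
    ∃ p, IsHomog b p ∧ eval 1 p = c := by
  obtain ⟨m, rfl⟩ := exists_multidegree_eq hb
  exact ⟨monomial m c, isHomog_monomial m c, eval_one_monomial m c⟩

theorem IsHomog.eval_one_eq_zero_of_mem_irrelevantIdeal {p : MvPolynomial V K} (hp : IsHomog 0 p)
    (h : p ∈ irrelevantIdeal V K) : eval 1 p = 0 := by
  have hC : p = C (eval 1 p) := IsHomog.eq_monomial (m := 0) hp
  rw [hC] at h
  have := (C_mem_pow_idealOfVars_iff (σ := V) 1 (eval 1 p)).1 (by rwa [pow_one])
  simpa using this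

end Homogeneous

section GradedMap

variable {V K : Type*} [Field K] {r s : ℕ} {deg : Fin r → V → ℤ} {deg' : Fin s → V → ℤ}
  {φ : (Fin r → MvPolynomial V K) →ₗ[MvPolynomial V K] (Fin s → MvPolynomial V K)}

/-- A multigraded map, of degree zero, of free modules. -/
def IsGraded (deg : Fin r → V → ℤ) (deg' : Fin s → V → ℤ)
    (φ : (Fin r → MvPolynomial V K) →ₗ[MvPolynomial V K] (Fin s → MvPolynomial V K)) : Prop :=
  ∀ b f, IsHomogVec deg b f → IsHomogVec deg' b (φ f)

theorem map_eq_sum_smul_single {ι R M : Type*} [Fintype ι] [DecidableEq ι] [Semiring R]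
    [AddCommMonoid M] [Module R M] (ψ : (ι → R) →ₗ[R] M) (f : ι → R) :
    ψ f = ∑ k, f k • ψ (Pi.single k 1) := by
  conv_lhs => rw [pi_eq_sum_univ' f, map_sum]
  simp only [← map_smul, ← Pi.single_smul, smul_eq_mul, mul_one]

theorem isHomogVec_single {k : Fin r} {b : V → ℤ} {p : MvPolynomial V K}
    (hp : IsHomog b p) : IsHomogVec deg (b + deg k) (Pi.single k p) := by
  intro l
  rcases eq_or_ne l k with rfl | h
  · simpa using hp
  · simpa [h] using isHomog_zero _

theorem isHomogVec_single_one (k : Fin r) :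
    IsHomogVec deg (deg k) (Pi.single k (1 : MvPolynomial V K)) := by
  simpa using isHomogVec_single (deg := deg) (k := k) isHomog_one

/-- The component of degree `b` of an element of the free module with generators of degrees
`deg k`. -/
noncomputable def vecComponent [DecidableEq V] (deg : Fin r → V → ℤ) (b : V → ℤ) :
    (Fin r → MvPolynomial V K) →ₗ[K] (Fin r → MvPolynomial V K) :=
  LinearMap.pi fun k =>
    weightedHomogeneousComponent (fun v => (Pi.single v 1 : V → ℤ)) (b - deg k) ∘ₗ
      LinearMap.proj k

theorem isHomogVec_vecComponent [DecidableEq V] (b : V → ℤ) (f : Fin r → MvPolynomial V K) :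
    IsHomogVec deg b (vecComponent deg b f) := fun k =>
  isHomog_iff_isWeightedHomogeneous.2
    (weightedHomogeneousComponent_isWeightedHomogeneous (b - deg k) (f k))

theorem IsHomogVec.vecComponent_self [DecidableEq V] {b : V → ℤ} {f : Fin r → MvPolynomial V K}
    (hf : IsHomogVec deg b f) : vecComponent deg b f = f :=
  funext fun k => (isHomog_iff_isWeightedHomogeneous.1 (hf k)).weightedHomogeneousComponent_same

theorem IsHomogVec.vecComponent_of_ne [DecidableEq V] {b c : V → ℤ}
    {f : Fin r → MvPolynomial V K} (hf : IsHomogVec deg b f) (h : c ≠ b) :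
    vecComponent deg c f = 0 :=
  funext fun k => (isHomog_iff_isWeightedHomogeneous.1 (hf k)).weightedHomogeneousComponent_ne _
    (sub_left_injective.ne h)

theorem IsGraded.map_vecComponent [DecidableEq V] (hφ : IsGraded deg deg' φ) (b : V → ℤ)
    (f : Fin r → MvPolynomial V K) : φ (vecComponent deg b f) = vecComponent deg' b (φ f) := by
  suffices h : φ.restrictScalars K ∘ₗ vecComponent deg b =
      vecComponent deg' b ∘ₗ φ.restrictScalars K from LinearMap.congr_fun h f
  refine LinearMap.pi_ext fun k p => ?_
  induction p using MvPolynomial.induction_on' with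
  | add p q hp hq => rw [Pi.single_add, map_add, map_add, hp, hq]
  | monomial m c =>
    have hm : IsHomogVec deg _ (Pi.single k (monomial m c)) :=
      isHomogVec_single (isHomog_monomial m c)
    simp only [LinearMap.comp_apply, LinearMap.coe_restrictScalars]
    rcases eq_or_ne b (multidegree m + deg k) with rfl | hb
    · rw [hm.vecComponent_self, (hφ _ _ hm).vecComponent_self]
    · rw [hm.vecComponent_of_ne hb, (hφ _ _ hm).vecComponent_of_ne hb, map_zero]

theorem IsGraded.exists_isHomogVec_map_eq (hφ : IsGraded deg deg' φ) {b : V → ℤ}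
    {f : Fin s → MvPolynomial V K} (hf : IsHomogVec deg' b f) (hfφ : f ∈ LinearMap.range φ) :
    ∃ g, IsHomogVec deg b g ∧ φ g = f := by
  classical
  obtain ⟨g, rfl⟩ := hfφ
  exact ⟨vecComponent deg b g, isHomogVec_vecComponent b g, by
    rw [hφ.map_vecComponent, hf.vecComponent_self]⟩

end GradedMap

section Dehomogenization

variable {V K : Type*} [Field K] {r s : ℕ} {deg : Fin r → V → ℤ} {deg' : Fin s → V → ℤ}

/-- The vector of scalars obtained by setting all variables to one. On the component of degree `b`
this is injective, with image `degSupported K deg (Set.Iic b)`. -/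
noncomputable def dehomogenize (f : Fin r → MvPolynomial V K) : Fin r →₀ K :=
  Finsupp.equivFunOnFinite.symm fun k => eval 1 (f k)

theorem dehomogenize_apply (f : Fin r → MvPolynomial V K) (k : Fin r) :
    dehomogenize f k = eval 1 (f k) := rfl

theorem linearCombination_dehomogenize {E : Type*} [AddCommGroup E] [Module K E] (w : Fin r → E)
    (f : Fin r → MvPolynomial V K) :
    Finsupp.linearCombination K w (dehomogenize f) = ∑ k, eval 1 (f k) • w k := by
  rw [Finsupp.linearCombination_apply, Finsupp.sum_fintype _ _ (by simp)]
  rfl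

/-- The linear map obtained by setting all variables to one in a matrix of polynomials. -/
noncomputable def dehomogenizeMap
    (φ : (Fin r → MvPolynomial V K) →ₗ[MvPolynomial V K] (Fin s → MvPolynomial V K)) :
    (Fin r →₀ K) →ₗ[K] (Fin s →₀ K) :=
  Finsupp.linearCombination K fun l => dehomogenize (φ (Pi.single l 1))

theorem dehomogenizeMap_dehomogenize
    (φ : (Fin r → MvPolynomial V K) →ₗ[MvPolynomial V K] (Fin s → MvPolynomial V K))
    (f : Fin r → MvPolynomial V K) :
    dehomogenizeMap φ (dehomogenize f) = dehomogenize (φ f) := by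
  ext k
  rw [dehomogenizeMap, linearCombination_dehomogenize, map_eq_sum_smul_single φ f]
  simp [dehomogenize_apply, Finsupp.finsetSum_apply]

theorem IsHomogVec.dehomogenize_eq_zero_iff {b : V → ℤ} {f : Fin r → MvPolynomial V K}
    (hf : IsHomogVec deg b f) : dehomogenize f = 0 ↔ f = 0 := by
  rw [Finsupp.ext_iff, _root_.funext_iff]
  exact forall_congr' fun k => (hf k).eval_one_eq_zero_iff

theorem mem_degSupported_Iic_iff [Finite V] {b : V → ℤ} {a : Fin r →₀ K} :
    a ∈ degSupported K deg (Set.Iic b) ↔ ∃ f, IsHomogVec deg b f ∧ dehomogenize f = a := by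
  constructor
  · intro ha
    have hcoord : ∀ k, ∃ p, IsHomog (b - deg k) p ∧ eval 1 p = a k := fun k => by
      by_cases hk : a k = 0
      · exact ⟨0, isHomog_zero _, by rw [map_zero, hk]⟩
      · exact exists_isHomog_eval_one_eq (sub_nonneg.2 (ha (Finsupp.mem_support_iff.2 hk))) _
    choose f hf hfa using hcoord
    exact ⟨f, hf, Finsupp.ext hfa⟩
  · rintro ⟨f, hf, rfl⟩ k hk
    exact sub_nonneg.1 ((hf k).nonneg ((hf k).eval_one_eq_zero_iff.not.1
      (Finsupp.mem_support_iff.1 hk)))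

theorem mem_map_dehomogenizeMap_iff [Finite V]
    {φ : (Fin r → MvPolynomial V K) →ₗ[MvPolynomial V K] (Fin s → MvPolynomial V K)}
    (hφ : IsGraded deg deg' φ) {b : V → ℤ} {a : Fin s →₀ K} :
    a ∈ (degSupported K deg (Set.Iic b)).map (dehomogenizeMap φ) ↔
      ∃ f ∈ LinearMap.range φ, IsHomogVec deg' b f ∧ dehomogenize f = a := by
  constructor
  · rintro ⟨c, hc, rfl⟩
    obtain ⟨g, hg, rfl⟩ := mem_degSupported_Iic_iff.1 hc
    exact ⟨φ g, ⟨g, rfl⟩, hφ b g hg, (dehomogenizeMap_dehomogenize φ g).symm⟩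
  · rintro ⟨f, hfφ, hf, rfl⟩
    obtain ⟨g, hg, rfl⟩ := hφ.exists_isHomogVec_map_eq hf hfφ
    exact ⟨dehomogenize g, mem_degSupported_Iic_iff.2 ⟨g, hg, rfl⟩,
      dehomogenizeMap_dehomogenize φ g⟩

end Dehomogenization

section MonomialIdeal

variable {V K : Type*} [Field K] {I : Ideal (MvPolynomial V K)}

/-- The ideal `I` is spanned by monomials: it contains each monomial that occurs in one of its
elements. -/
def IsMonomial (I : Ideal (MvPolynomial V K)) : Prop :=
  ∀ p ∈ I, ∀ m ∈ p.support, monomial m 1 ∈ I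

/-- The degrees of the standard monomials of `I`, that is, of the monomials outside `I`. -/
def standardDegrees (I : Ideal (MvPolynomial V K)) : Set (V → ℤ) :=
  multidegree '' {m | monomial m 1 ∉ I}

theorem multidegree_mem_standardDegrees_iff {m : V →₀ ℕ} :
    multidegree m ∈ standardDegrees I ↔ monomial m 1 ∉ I :=
  multidegree_injective.mem_set_image

theorem IsHomog.mem_ideal_iff {b : V → ℤ} {p : MvPolynomial V K} (hp : IsHomog b p) :
    p ∈ I ↔ (b ∈ standardDegrees I → eval 1 p = 0) := by
  rcases eq_or_ne p 0 with rfl | hp0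
  · simp
  obtain ⟨m, rfl⟩ := hp.exists_eq_multidegree hp0
  have hne : eval 1 p ≠ 0 := hp.eval_one_eq_zero_iff.not.2 hp0
  have hmonomial : p = C (eval 1 p) * monomial m 1 := by
    rw [C_mul_monomial, mul_one, ← hp.eq_monomial]
  have hmem : p ∈ I ↔ monomial m 1 ∈ I := by
    rw [hmonomial, Ideal.unit_mul_mem_iff_mem I (hne.isUnit.map C)]
  rw [hmem, multidegree_mem_standardDegrees_iff]
  tauto

end MonomialIdeal

namespace MinimalFreeResolution

variable {V K : Type*} [Field K] {I : Ideal (MvPolynomial V K)} (F : MinimalFreeResolution I)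

theorem exists_augPoly (k : Fin (F.rank 0)) :
    ∃ p, IsHomog (F.deg 0 k) p ∧ F.aug (Pi.single k 1) = Ideal.Quotient.mk I p ∧
      (F.deg 0 k ∉ standardDegrees I → p = 0) := by
  obtain ⟨p, hp, hpk⟩ := F.aug_homog _ _ (isHomogVec_single_one k)
  by_cases hk : F.deg 0 k ∈ standardDegrees I
  · exact ⟨p, hp, hpk, absurd hk⟩
  · refine ⟨0, isHomog_zero _, ?_, fun _ => rfl⟩
    rw [hpk, map_zero, Ideal.Quotient.eq_zero_iff_mem, hp.mem_ideal_iff]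
    exact fun h => absurd h hk

/-- A homogeneous representative of the image of the `k`-th basis vector in `A ⧸ I`. It is chosen
to be zero whenever it lies in `I`. -/
noncomputable def augPoly (k : Fin (F.rank 0)) : MvPolynomial V K :=
  (F.exists_augPoly k).choose

theorem isHomog_augPoly (k : Fin (F.rank 0)) : IsHomog (F.deg 0 k) (F.augPoly k) :=
  (F.exists_augPoly k).choose_spec.1

theorem augPoly_eq_zero {k : Fin (F.rank 0)} (hk : F.deg 0 k ∉ standardDegrees I) :
    F.augPoly k = 0 :=
  (F.exists_augPoly k).choose_spec.2.2 hk

theorem aug_apply (f : Fin (F.rank 0) → MvPolynomial V K) :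
    F.aug f = Ideal.Quotient.mk I (∑ k, f k * F.augPoly k) := by
  rw [map_eq_sum_smul_single, map_sum]
  refine Finset.sum_congr rfl fun k _ => ?_
  rw [(F.exists_augPoly k).choose_spec.2.1]
  rfl

theorem isHomog_sum_augPoly {b : V → ℤ} {f : Fin (F.rank 0) → MvPolynomial V K}
    (hf : IsHomogVec (F.deg 0) b f) : IsHomog b (∑ k, f k * F.augPoly k) :=
  .sum fun k _ => by simpa using (hf k).mul (F.isHomog_augPoly k)

/-- The complex of vector spaces obtained from a free resolution by setting all variables to
one. -/
noncomputable def dehomogenization : AugmentedComplex K fun i => Fin (F.rank i) where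
  d i := dehomogenizeMap (F.d i)
  aug := Finsupp.linearCombination K fun k => eval 1 (F.augPoly k)

theorem dehomogenization_aug_dehomogenize (f : Fin (F.rank 0) → MvPolynomial V K) :
    F.dehomogenization.aug (dehomogenize f) = eval 1 (∑ k, f k * F.augPoly k) := by
  rw [dehomogenization, linearCombination_dehomogenize]
  simp

theorem aug_eq_zero_iff {b : V → ℤ} {f : Fin (F.rank 0) → MvPolynomial V K}
    (hf : IsHomogVec (F.deg 0) b f) :
    F.aug f = 0 ↔ (b ∈ standardDegrees I → F.dehomogenization.aug (dehomogenize f) = 0) := by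
  rw [aug_apply, Ideal.Quotient.eq_zero_iff_mem, (F.isHomog_sum_augPoly hf).mem_ideal_iff,
    dehomogenization_aug_dehomogenize]

theorem mem_cycles_iff [Finite V] {i : ℕ} {b : V → ℤ} {a : Fin (F.rank i) →₀ K} :
    a ∈ F.dehomogenization.cycles F.deg (standardDegrees I) i b ↔
      ∃ f ∈ LinearMap.range (F.d i), IsHomogVec (F.deg i) b f ∧ dehomogenize f = a := by
  rcases i with _ | i
  · rw [AugmentedComplex.cycles, mem_kernelAt, mem_degSupported_Iic_iff]
    constructor
    · rintro ⟨⟨f, hf, rfl⟩, haug⟩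
      exact ⟨f, (F.exact_aug f).1 ((F.aug_eq_zero_iff hf).2 haug), hf, rfl⟩
    · rintro ⟨f, hfd, hf, rfl⟩
      exact ⟨⟨f, hf, rfl⟩, (F.aug_eq_zero_iff hf).1 ((F.exact_aug f).2 hfd)⟩
  · have hker : ∀ f, IsHomogVec (F.deg (i + 1)) b f →
        (F.dehomogenization.d i (dehomogenize f) = 0 ↔ f ∈ LinearMap.range (F.d (i + 1))) :=
      fun f hf => by
        rw [dehomogenization, dehomogenizeMap_dehomogenize,
          (F.d_homog i b f hf).dehomogenize_eq_zero_iff]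
        exact F.exact i f
    rw [AugmentedComplex.cycles, mem_kernelAt, mem_degSupported_Iic_iff]
    constructor
    · rintro ⟨⟨f, hf, rfl⟩, hd⟩
      exact ⟨f, (hker f hf).1 (hd trivial), hf, rfl⟩
    · rintro ⟨f, hfd, hf, rfl⟩
      exact ⟨⟨f, hf, rfl⟩, fun _ => (hker f hf).2 hfd⟩

theorem apply_mem_irrelevantIdeal {i : ℕ} {f : Fin (F.rank i) → MvPolynomial V K}
    (hf : f ∈ LinearMap.range (F.d i)) (k : Fin (F.rank i)) : f k ∈ irrelevantIdeal V K := by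
  have hle : irrelevantIdeal V K • ⊤ ≤ Submodule.comap
      (LinearMap.proj k : (Fin (F.rank i) → MvPolynomial V K) →ₗ[MvPolynomial V K]
        MvPolynomial V K) (irrelevantIdeal V K) :=
    Submodule.smul_le.2 fun p hp _ _ => Ideal.mul_mem_right _ _ hp
  exact hle (F.minimal i hf)

theorem exists_aug_ne_zero (hI : IsMonomial I) {b : V → ℤ} (hb : b ∈ standardDegrees I) :
    ∃ k, F.deg 0 k ≤ b ∧ eval 1 (F.augPoly k) ≠ 0 := by
  classical
  obtain ⟨m, hm, rfl⟩ := hb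
  obtain ⟨f, hf⟩ := F.aug_surjective (Ideal.Quotient.mk I (monomial m 1))
  rw [F.aug_apply, Ideal.Quotient.eq] at hf
  have hcoeff : coeff m (∑ k, f k * F.augPoly k) ≠ 0 := fun h =>
    hm (hI _ hf m (by simp [h, coeff_monomial]))
  rw [coeff_sum] at hcoeff
  obtain ⟨k, -, hk⟩ := Finset.exists_ne_zero_of_sum_ne_zero hcoeff
  classical
  obtain ⟨m₁, -, m₂, hm₂, rfl⟩ := Finset.mem_add.1 (support_mul _ _ (mem_support_iff.2 hk))
  refine ⟨k, fun v => ?_, (F.isHomog_augPoly k).eval_one_eq_zero_iff.not.2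
    (support_nonempty.1 ⟨m₂, hm₂⟩)⟩
  rw [← F.isHomog_augPoly k m₂ hm₂ v]
  simp [multidegree]

theorem isMinimalResolution_dehomogenization [Finite V] (hI : IsMonomial I) :
    F.dehomogenization.IsMinimalResolution F.deg (standardDegrees I) where
  aug_single k hk := by
    simp [dehomogenization, F.augPoly_eq_zero hk]
  map_aug b hb := by
    obtain ⟨k, hkb, hk⟩ := F.exists_aug_ne_zero hI hb
    refine Submodule.eq_top_iff'.2 fun c =>
      ⟨_, single_mem_degSupported hkb (c / eval 1 (F.augPoly k)), ?_⟩
    simp [dehomogenization, hk]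
  map_d i b := by
    ext a
    rw [mem_cycles_iff]
    exact mem_map_dehomogenizeMap_iff (F.d_homog i)
  cycles_le i b a ha := by
    obtain ⟨f, hfd, hf, rfl⟩ := F.mem_cycles_iff.1 ha
    intro k hk
    have hle : F.deg i k ≤ b := mem_degSupported_Iic_iff.2 ⟨f, hf, rfl⟩ hk
    refine hle.lt_of_ne fun hkb => ?_
    have hfk : IsHomog 0 (f k) := by simpa [hkb] using hf k
    exact Finsupp.mem_support_iff.1 hk
      (hfk.eval_one_eq_zero_of_mem_irrelevantIdeal (F.apply_mem_irrelevantIdeal hfd k))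

end MinimalFreeResolution

end Multigraded

namespace SpernerHypergraph

section EdgeIdeal

variable {V K : Type*} [Field K] (H : SpernerHypergraph V)

theorem mem_edgeIdeal_iff {p : MvPolynomial V K} :
    p ∈ H.edgeIdeal K ↔ ∀ m ∈ p.support, ∃ e ∈ H.edges, ∀ v ∈ e, 0 < m v := by
  classical
  have hspan : {p : MvPolynomial V K | ∃ e ∈ H.edges, p = ∏ v ∈ e, X v} =
      (fun m => monomial m (1 : K)) ''
        ((fun e : Finset V => ∑ v ∈ e, Finsupp.single v 1) '' H.edges) := by
    ext p
    simp only [Set.image_image, monomial_sum_one, Set.mem_image, Set.mem_ofPred_eq,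
      eq_comm (a := p)]
    rfl
  have hle : ∀ (e : Finset V) (m : V →₀ ℕ),
      ∑ v ∈ e, Finsupp.single v 1 ≤ m ↔ ∀ v ∈ e, 0 < m v := fun e m => by
    simp only [Finsupp.le_def, Finsupp.finsetSum_apply, Finsupp.single_apply, Finset.sum_ite_eq']
    grind
  rw [edgeIdeal, hspan, mem_ideal_span_monomial_image]
  simp only [Set.exists_mem_image, hle]

theorem monomial_mem_edgeIdeal_iff {m : V →₀ ℕ} :
    monomial m (1 : K) ∈ H.edgeIdeal K ↔ ∃ e ∈ H.edges, ∀ v ∈ e, 0 < m v := by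
  classical
  simp [mem_edgeIdeal_iff, support_monomial, -mem_support_iff]

theorem isMonomial_edgeIdeal : Multigraded.IsMonomial (H.edgeIdeal K) :=
  fun _ hp m hm => H.monomial_mem_edgeIdeal_iff.2 (H.mem_edgeIdeal_iff.1 hp m hm)

theorem mem_standardDegrees_edgeIdeal_iff [Finite V] {b : V → ℤ} :
    b ∈ Multigraded.standardDegrees (H.edgeIdeal K) ↔
      0 ≤ b ∧ ∀ e ∈ H.edges, ∃ v ∈ e, b v ≤ 0 := by
  constructor
  · rintro ⟨m, hm, rfl⟩
    simpa [monomial_mem_edgeIdeal_iff, Multigraded.multidegree, Pi.le_def] using hm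
  · rintro ⟨hb, hedges⟩
    obtain ⟨m, rfl⟩ := Multigraded.exists_multidegree_eq hb
    simpa [Multigraded.multidegree_mem_standardDegrees_iff, monomial_mem_edgeIdeal_iff,
      Multigraded.multidegree] using hedges

end EdgeIdeal

section Cards

variable {V V' K : Type*} [Field K] {H : SpernerHypergraph V} {H' : SpernerHypergraph V'}

theorem Isomorphic.exists_extend_deleteVertex {v : V} {v' : V'}
    (h : (H.deleteVertex v).Isomorphic (H'.deleteVertex v')) :
    ∃ ψ : V ≃ V', ψ v = v' ∧
      ∀ e : Finset V, v ∉ e → (e ∈ H.edges ↔ e.map ψ.toEmbedding ∈ H'.edges) := by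
  classical
  obtain ⟨φ, hφ⟩ := h
  let ψ : V ≃ V' := (Equiv.Set.sumCompl {v}).symm.trans
    ((Equiv.sumCongr (Equiv.ofUnique ({v} : Set V) ({v'} : Set V')) φ).trans
      (Equiv.Set.sumCompl {v'}))
  have hψv : ψ v = v' := by
    simp [ψ, Equiv.Set.sumCompl_symm_apply_of_mem (Set.mem_singleton v)]
  have hψ : ∀ x : ({v}ᶜ : Set V), ψ x = φ x := fun x => by
    simp [ψ, Equiv.Set.sumCompl_symm_apply_of_notMem x.2]
  refine ⟨ψ, hψv, fun e he => ?_⟩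
  obtain ⟨e, rfl⟩ : ∃ e₀ : Finset ({v}ᶜ : Set V), e₀.map (Function.Embedding.subtype _) = e :=
    ⟨e.subtype _, Finset.subtype_map_of_mem fun x hx (h : x = v) => he (h ▸ hx)⟩
  have hmap : (e.map φ.toEmbedding).map (Function.Embedding.subtype _) =
      (e.map (Function.Embedding.subtype _)).map ψ.toEmbedding := by
    rw [Finset.map_map, Finset.map_map]
    congr 1
    ext x
    exact (hψ x).symm
  rw [← hmap]
  exact hφ e

theorem comp_mem_standardDegrees_iff [Finite V] [Finite V'] {ψ : V ≃ V'} {v : V}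
    (hψ : ∀ e : Finset V, v ∉ e → (e ∈ H.edges ↔ e.map ψ.toEmbedding ∈ H'.edges)) {b : V' → ℤ}
    (hb : b (ψ v) ≤ 0) :
    b ∘ ψ ∈ Multigraded.standardDegrees (H.edgeIdeal K) ↔
      b ∈ Multigraded.standardDegrees (H'.edgeIdeal K) := by
  rw [mem_standardDegrees_edgeIdeal_iff, mem_standardDegrees_edgeIdeal_iff]
  refine and_congr (ψ.forall_congr fun _ => Iff.rfl) (ψ.finsetCongr.forall_congr fun {e} => ?_)
  have hexists : (∃ y ∈ e.map ψ.toEmbedding, b y ≤ 0) ↔ ∃ x ∈ e, b (ψ x) ≤ 0 := by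
    simp only [Finset.mem_map, exists_exists_and_eq_and]
    rfl
  rw [Equiv.finsetCongr_apply, hexists]
  by_cases hv : v ∈ e
  · exact iff_of_true (fun _ => ⟨v, hv, hb⟩) fun _ => ⟨v, hv, hb⟩
  · exact imp_congr (hψ e hv) Iff.rfl

end Cards

end SpernerHypergraph

namespace Multigraded

section VertexWeight

variable {V V' : Type*} [Fintype V] [Fintype V']

open Classical in
/-- The weight of the vertex `v` in a degree `b` of total degree `j`: a total weight of one is
distributed evenly among the vertices at which `b` is not positive. All weights are zero if the
total degree of `b` is not `j`. -/
noncomputable def vertexWeight (j : ℤ) (v : V) (b : V → ℤ) : ℚ :=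
  if ∑ x, b x = j ∧ b v ≤ 0 then (Fintype.card {x // b x ≤ 0} : ℚ)⁻¹ else 0

theorem nonpos_of_vertexWeight_ne_zero {j : ℤ} {v : V} {b : V → ℤ} (h : vertexWeight j v b ≠ 0) :
    b v ≤ 0 := by
  by_contra hv
  exact h (if_neg fun hb => hv hb.2)

theorem vertexWeight_comp (ψ : V ≃ V') (j : ℤ) (v : V) (b : V' → ℤ) :
    vertexWeight j v (b ∘ ψ) = vertexWeight j (ψ v) b := by
  have hsum : ∑ x, (b ∘ ψ) x = ∑ x, b x := ψ.sum_comp b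
  have hcard : Fintype.card {x // (b ∘ ψ) x ≤ 0} = Fintype.card {x // b x ≤ 0} :=
    Fintype.card_congr (ψ.subtypeEquiv fun _ => Iff.rfl)
  rw [vertexWeight, vertexWeight, hsum, hcard, Function.comp_apply]

theorem exists_nonpos_of_sum_lt {b : V → ℤ} (hb : ∑ x, b x < Fintype.card V) : ∃ x, b x ≤ 0 := by
  have hlt : ∑ x, b x < ∑ _ : V, 1 := by simpa using hb
  obtain ⟨x, -, hx⟩ := Finset.exists_lt_of_sum_lt hlt
  exact ⟨x, Int.lt_add_one_iff.1 hx⟩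

theorem sum_vertexWeight {j : ℤ} (hj : j < Fintype.card V) (b : V → ℤ) :
    ∑ v, vertexWeight j v b = if ∑ x, b x = j then 1 else 0 := by
  classical
  split_ifs with h
  · obtain ⟨x, hx⟩ := exists_nonpos_of_sum_lt (h ▸ hj)
    have : Nonempty {x // b x ≤ 0} := ⟨⟨x, hx⟩⟩
    simp [vertexWeight, h, ← Finset.sum_filter, ← Fintype.card_subtype]
  · simp [vertexWeight, h]

end VertexWeight

namespace MinimalFreeResolution

variable {V V' K : Type*} [Field K]

theorem finite_support_multigradedBetti {I : Ideal (MvPolynomial V K)}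
    (F : MinimalFreeResolution I) (i : ℕ) : (F.multigradedBetti i).support.Finite := by
  refine (Set.finite_range (F.deg i)).subset fun b hb => ?_
  obtain ⟨k, hk⟩ := (Nat.card_ne_zero.1 hb).1
  exact ⟨k, hk⟩

/-- The contribution of the card `H - v` to the graded Betti number in homological degree `i` and
degree `j`. -/
noncomputable def cardBetti [Fintype V] {I : Ideal (MvPolynomial V K)}
    (F : MinimalFreeResolution I) (i : ℕ) (j : ℤ) (v : V) : ℚ :=
  ∑ᶠ b, F.multigradedBetti i b * vertexWeight j v b

theorem sum_cardBetti [Fintype V] {I : Ideal (MvPolynomial V K)} (F : MinimalFreeResolution I)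
    (i : ℕ) {j : ℤ} (hj : j < Fintype.card V) : ∑ v, F.cardBetti i j v = F.gradedBetti i j := by
  have hfinite : ∀ w : (V → ℤ) → ℚ,
      (fun b => F.multigradedBetti i b * w b).support.Finite := fun w =>
    (F.finite_support_multigradedBetti i).subset fun b hb h => hb (by simp [h])
  simp only [cardBetti, gradedBetti]
  rw [← finsum_sum_comm _ _ fun v _ => hfinite _]
  rw [← Nat.coe_castAddMonoidHom,
    AddMonoidHom.map_finsum_of_injective _ (Nat.cast_injective (R := ℚ))]
  refine finsum_congr fun b => ?_
  rw [← Finset.mul_sum, sum_vertexWeight hj, finsum_eq_if]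
  split_ifs <;> simp

theorem multigradedBetti_comp [Finite V] [Finite V'] {H : SpernerHypergraph V}
    {H' : SpernerHypergraph V'} (F : MinimalFreeResolution (H.edgeIdeal K))
    (F' : MinimalFreeResolution (H'.edgeIdeal K)) {ψ : V ≃ V'} {v : V}
    (hψ : ∀ e : Finset V, v ∉ e → (e ∈ H.edges ↔ e.map ψ.toEmbedding ∈ H'.edges)) (i : ℕ)
    {b : V' → ℤ} (hb : b (ψ v) ≤ 0) :
    F.multigradedBetti i (b ∘ ψ) = F'.multigradedBetti i b := by
  let e : (V → ℤ) ≃o (V' → ℤ) :=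
    { toEquiv := ψ.arrowCongr (Equiv.refl ℤ)
      map_rel_iff' := ψ.symm.forall_congr fun _ => Iff.rfl }
  have hF := (F.isMinimalResolution_dehomogenization H.isMonomial_edgeIdeal).mapDeg e
  have hF' := F'.isMinimalResolution_dehomogenization H'.isMonomial_edgeIdeal
  have hfiber := hF.ncard_fiber_eq hF' (Q := {b | b (ψ v) ≤ 0})
    (fun a b hba ha => (hba (ψ v)).trans ha)
    (fun b hb => SpernerHypergraph.comp_mem_standardDegrees_iff hψ hb) i hb
  calc F.multigradedBetti i (b ∘ ψ)
    _ = Nat.card {k // e (F.deg i k) = b} :=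
      Nat.card_congr (Equiv.subtypeEquivRight fun _ => e.toEquiv.eq_symm_apply)
    _ = F'.multigradedBetti i b := hfiber

theorem cardBetti_eq [Fintype V] [Fintype V'] {H : SpernerHypergraph V}
    {H' : SpernerHypergraph V'} {v : V} {v' : V'}
    (h : (H.deleteVertex v).Isomorphic (H'.deleteVertex v'))
    (F : MinimalFreeResolution (H.edgeIdeal K)) (F' : MinimalFreeResolution (H'.edgeIdeal K))
    (i : ℕ) (j : ℤ) : F.cardBetti i j v = F'.cardBetti i j v' := by
  obtain ⟨ψ, rfl, hψ⟩ := h.exists_extend_deleteVertex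
  rw [cardBetti, ← finsum_comp_equiv (ψ.symm.arrowCongr (Equiv.refl ℤ))]
  refine finsum_congr fun b => ?_
  change F.multigradedBetti i (b ∘ ψ) * vertexWeight j v (b ∘ ψ) = _
  rw [vertexWeight_comp]
  by_cases hw : vertexWeight j (ψ v) b = 0
  · rw [hw, mul_zero, mul_zero]
  · rw [F.multigradedBetti_comp F' hψ i (nonpos_of_vertexWeight_ne_zero hw)]

end MinimalFreeResolution

end Multigraded

theorem corollary4p8_general {K : Type*} [Field K] {V V' : Type*} [Fintype V] [Fintype V']
    (H : SpernerHypergraph V) (H' : SpernerHypergraph V') (hdeck : H.SameDeck H')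
    (F : Multigraded.MinimalFreeResolution (H.edgeIdeal K))
    (F' : Multigraded.MinimalFreeResolution (H'.edgeIdeal K))
    (i : ℕ) (j : ℤ) (hj : j < Fintype.card V) :
    F.gradedBetti i j = F'.gradedBetti i j := by
  obtain ⟨σ, hσ⟩ := hdeck
  have hj' : j < Fintype.card V' := Fintype.card_congr σ ▸ hj
  have hcast : (F.gradedBetti i j : ℚ) = F'.gradedBetti i j :=
    calc (F.gradedBetti i j : ℚ)
      _ = ∑ v, F.cardBetti i j v := (F.sum_cardBetti i hj).symm
      _ = ∑ v, F'.cardBetti i j (σ v) :=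
        Finset.sum_congr rfl fun v _ => F.cardBetti_eq (hσ v) F' i j
      _ = ∑ v', F'.cardBetti i j v' := σ.sum_comp _
      _ = F'.gradedBetti i j := F'.sum_cardBetti i hj'
  exact_mod_cast hcast

theorem corollary4p8 {K : Type*} [Field K] [CharZero K] {V V' : Type*} [Fintype V] [Fintype V']
    (n : ℕ) (hn : 3 ≤ n) (H : SpernerHypergraph V) (H' : SpernerHypergraph V')
    (hV : Fintype.card V = n) (hV' : Fintype.card V' = n) (hdeck : H.SameDeck H')
    (F : Multigraded.MinimalFreeResolution (H.edgeIdeal K))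
    (F' : Multigraded.MinimalFreeResolution (H'.edgeIdeal K))
    (i : ℕ) (j : ℤ) (hj : j < n) :
    F.gradedBetti i j = F'.gradedBetti i j :=
  corollary4p8_general H H' hdeck F F' i j (hV ▸ hj)
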